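/- Let $R$ be a commutative Noetherian ring with identity, $\mathfrak a$ an ideal of $R$, and $\mathcal S$ a Serre subcategory of the category of $R$-modules, i.e. a class of $R$-modules containing $0$ and closed under submodules, quotients and extensions (hence under isomorphism). For an $R$-module $Y$ let $\Gamma_{\mathfrak a}(Y)=\{y\in Y : \mathfrak a^k y=0 \text{ for some } k\ge 0\}$, and let $H^i_{\mathfrak a}$ denote the $i$-th right derived functor of $\Gamma_{\mathfrak a}$. Call $Y$ $(\mathcal S,\mathfrak a)$-cofinite if $\operatorname{Supp}_R(Y)\subseteq V(\mathfrak a)$ and $\operatorname{Ext}^i_R(R/\mathfrak a,Y)\in\mathcal S$ for all $i\ge 0$. **Theorem 4.2.** Let $X$ be an $R$-module and $n$ a non-negative integer such that $H^i_{\mathfrak a}(X)$ is $(\mathcal S,\mathfrak a)$-cofinite for all $i\ge 0$ with $i\neq n$. Then the following statements are equivalent: 1. $\operatorname{Ext}^i_R(R/\mathfrak a,X)\in\mathcal S$ for all $i\ge 0$. 2. $\operatorname{Ext}^i_R(R/\mathfrak a,X)\in\mathcal S$ for all $i\ge n$. 3. $H^n_{\mathfrak a}(X)$ is $(\mathcal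 S,\mathfrak a)$-cofinite. -/

import Mathlib

open CategoryTheory

universe u

namespace SerreCofinite

variable {R : Type u} [CommRing R]

/-- The `𝔞`-torsion submodule `Γ_𝔞(M) = ⋃ₖ (0 :_M 𝔞ᵏ)` of an `R`-module `M`. -/
def torsionSubmodule (𝔞 : Ideal R) (M : Type u) [AddCommGroup M] [Module R M] :
    Submodule R M where
  carrier := {x | ∃ k : ℕ, ∀ r ∈ 𝔞 ^ k, r • x = 0}
  zero_mem' := ⟨0, fun r _ => smul_zero r⟩
  add_mem' := by
    rintro x y ⟨k, hk⟩ ⟨l, hl⟩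
    refine ⟨k + l, fun r hr => ?_⟩
    rw [smul_add, hk r (Ideal.pow_le_pow_right (Nat.le_add_right k l) hr),
      hl r (Ideal.pow_le_pow_right (Nat.le_add_left l k) hr), add_zero]
  smul_mem' := by
    rintro c x ⟨k, hk⟩
    exact ⟨k, fun r hr => by rw [smul_comm, hk r hr, smul_zero]⟩

theorem map_mem_torsionSubmodule (𝔞 : Ideal R) {M N : Type u} [AddCommGroup M] [Module R M]
    [AddCommGroup N] [Module R N] (f : M →ₗ[R] N) (x : M) (hx : x ∈ torsionSubmodule 𝔞 M) :
    f x ∈ torsionSubmodule 𝔞 N := by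
  obtain ⟨k, hk⟩ := hx
  exact ⟨k, fun r hr => by rw [← map_smul, hk r hr, map_zero]⟩

/-- The `𝔞`-torsion functor `Γ_𝔞`; on morphisms it is restriction. -/
def torsionFunctor (𝔞 : Ideal R) : ModuleCat.{u} R ⥤ ModuleCat.{u} R where
  obj M := ModuleCat.of R (torsionSubmodule 𝔞 M)
  map f := ModuleCat.ofHom (f.hom.restrict (map_mem_torsionSubmodule 𝔞 f.hom))

instance (𝔞 : Ideal R) : (torsionFunctor 𝔞).Additive where
  map_add := rfl

/-- The `i`-th local cohomology module `H^i_𝔞(X)`: the value at `X` of the `i`-th right derived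
functor of the `𝔞`-torsion functor `Γ_𝔞`. -/
noncomputable def localCohomologyModule (𝔞 : Ideal R) (i : ℕ) (X : ModuleCat.{u} R) :
    ModuleCat.{u} R :=
  ((torsionFunctor 𝔞).rightDerived i).obj X

/-- The `R`-module `Ext^i_R(R/𝔞, X)`. -/
noncomputable def extQuotient (𝔞 : Ideal R) (i : ℕ) (X : ModuleCat.{u} R) : ModuleCat.{u} R :=
  ModuleCat.of R (Abelian.Ext.{u} (ModuleCat.of R (R ⧸ 𝔞)) X i)

/-- `X` is `(𝒮, 𝔞)`-cofinite: `Supp_R(X) ⊆ V(𝔞)` and `Ext^i_R(R/𝔞, X) ∈ 𝒮` for all `i ≥ 0`. -/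
def IsCofinite (𝒮 : ObjectProperty (ModuleCat.{u} R)) (𝔞 : Ideal R) (X : ModuleCat.{u} R) :
    Prop :=
  Module.support R X ⊆ PrimeSpectrum.zeroLocus (𝔞 : Set R) ∧ ∀ i : ℕ, 𝒮 (extQuotient 𝔞 i X)

end SerreCofinite

/-! Let `I` be an injective resolution of `X`, `Zⁱ` its cocycles, `Eⁱ = Iⁱ/Γ(Iⁱ)` and `Yⁱ =
Zⁱ/d(Γ(Iⁱ⁻¹))`, so that `Y⁰ ≅ X`. Then `Hⁱ = Hⁱ(Γ(I))` embeds in `Yⁱ` with cokernel `Tⁱ`, the image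
of `Zⁱ` in `Eⁱ`, and exactness of `I` gives `Eⁱ/Tⁱ ≅ Yⁱ⁺¹`. By Artin–Rees `Γ` preserves injectives,
so `Eⁱ` is injective; it has no nonzero element killed by `𝔞`. Hence all `Ext(R/𝔞, Eⁱ)` vanish,
`Hom(R/𝔞, Tⁱ) = 0` and `Extᵖ⁺¹(R/𝔞, Tⁱ) ≅ Extᵖ(R/𝔞, Yⁱ⁺¹)`. These shifts replace a spectral
sequence: Ext of the `Hⁱ` controls Ext of `X` by induction on the degree (`prop_extQuotient_Y`), and
the one exceptional `Hⁿ` is recovered by induction on `n` (`prop_extQuotient_H`). The support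
condition is automatic. -/

namespace SerreCofinite

variable {R : Type u} [CommRing R]

/-! ### Torsion submodules and injectivity over a Noetherian ring. -/

section Torsion

variable {𝔞 : Ideal R} {M N : Type u} [AddCommGroup M] [Module R M] [AddCommGroup N] [Module R N]

/-- A finitely generated submodule of the `𝔞`-torsion is killed by a single power of `𝔞`. -/
theorem exists_pow_smul_eq_zero_of_fg {L : Submodule R M} (hL : L.FG)
    (h : L ≤ torsionSubmodule 𝔞 M) : ∃ k : ℕ, ∀ r ∈ 𝔞 ^ k, ∀ x ∈ L, r • x = 0 := by
  induction L, hL using Submodule.fg_induction with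
  | singleton x =>
    obtain ⟨k, hk⟩ := h (Submodule.mem_span_singleton_self x)
    refine ⟨k, fun r hr y hy => ?_⟩
    obtain ⟨c, rfl⟩ := Submodule.mem_span_singleton.1 hy
    rw [smul_comm, hk r hr, smul_zero]
  | sup L₁ L₂ _ _ h₁ h₂ =>
    obtain ⟨k, hk⟩ := h₁ (le_sup_left.trans h)
    obtain ⟨l, hl⟩ := h₂ (le_sup_right.trans h)
    refine ⟨k + l, fun r hr x hx => ?_⟩
    obtain ⟨y, hy, z, hz, rfl⟩ := Submodule.mem_sup.1 hx
    rw [smul_add, hk r (Ideal.pow_le_pow_right (Nat.le_add_right k l) hr) y hy,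
      hl r (Ideal.pow_le_pow_right (Nat.le_add_left l k) hr) z hz, add_zero]

/-- Over a Noetherian ring the torsion submodule `Γ_𝔞(M)` is closed in `M`: `M ⧸ Γ_𝔞(M)` has no
nonzero element killed by `𝔞`. -/
theorem mem_torsionSubmodule_of_smul_mem [IsNoetherianRing R] {x : M}
    (h : ∀ r ∈ 𝔞, r • x ∈ torsionSubmodule 𝔞 M) : x ∈ torsionSubmodule 𝔞 M := by
  -- The submodule `𝔞x` is finitely generated, so a single `𝔞ᵏ` kills it and `𝔞ᵏ⁺¹` kills `x`.
  obtain ⟨k, hk⟩ := exists_pow_smul_eq_zero_of_fg (𝔞 := 𝔞)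
    (L := Submodule.map (LinearMap.toSpanSingleton R M x) 𝔞)
    ((IsNoetherian.noetherian 𝔞).map _) (by rintro _ ⟨r, hr, rfl⟩; exact h r hr)
  refine ⟨k + 1, fun r hr => ?_⟩
  rw [pow_succ] at hr
  induction hr using Submodule.mul_induction_on' with
  | mem_mul_mem a ha b hb => rw [mul_smul]; exact hk a ha _ ⟨b, hb, rfl⟩
  | add y _ z _ hy hz => rw [add_smul, hy, hz, add_zero]

theorem eq_zero_of_smul_eq_zero_of_torsionQuotient [IsNoetherianRing R]
    {x : M ⧸ torsionSubmodule 𝔞 M} (h : ∀ r ∈ 𝔞, r • x = 0) : x = 0 := by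
  obtain ⟨x, rfl⟩ := Submodule.mkQ_surjective _ x
  rw [Submodule.mkQ_apply, Submodule.Quotient.mk_eq_zero]
  refine mem_torsionSubmodule_of_smul_mem fun r hr => ?_
  rw [← Submodule.Quotient.mk_eq_zero]
  exact h r hr

theorem linearMap_torsionQuotient_eq_zero [IsNoetherianRing R]
    (f : (R ⧸ 𝔞) →ₗ[R] M ⧸ torsionSubmodule 𝔞 M) : f = 0 := by
  refine Submodule.linearMap_qext _ (LinearMap.ext_ring ?_)
  refine eq_zero_of_smul_eq_zero_of_torsionQuotient fun r hr => ?_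
  have : r • (Submodule.mkQ 𝔞 1) = 0 := by
    rw [← map_smul, smul_eq_mul, mul_one, Submodule.mkQ_apply, Submodule.Quotient.mk_eq_zero]
    exact hr
  rw [LinearMap.comp_apply, ← map_smul, this, map_zero]

/-- Over a Noetherian ring the `𝔞`-torsion submodule of an injective module is injective. -/
theorem injective_torsionSubmodule [IsNoetherianRing R] [Module.Injective R M] :
    Module.Injective R (torsionSubmodule 𝔞 M) := by
  refine Module.Baer.injective fun J g => ?_
  have hfg : (LinearMap.range ((torsionSubmodule 𝔞 M).subtype ∘ₗ g)).FG := by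
    rw [LinearMap.range_eq_map]
    exact (Module.Finite.fg_top (R := R) (M := J)).map _
  obtain ⟨k, hk⟩ := exists_pow_smul_eq_zero_of_fg (𝔞 := 𝔞) hfg
    (by rintro _ ⟨y, rfl⟩; exact (g y).2)
  -- Artin–Rees: `𝔞ᵐ⁺ᵏ ∩ J ⊆ 𝔞ᵏJ`, and `g` vanishes there because `𝔞ᵏ` kills its image. So `g`
  -- factors through the image of `J` in `R/𝔞ᵐ⁺ᵏ`.
  obtain ⟨m, hm⟩ := Ideal.exists_pow_inf_eq_pow_smul 𝔞 (J : Submodule R R)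
  have hm' : ∀ x (hx : x ∈ J), x ∈ 𝔞 ^ (m + k) → g ⟨x, hx⟩ = 0 := by
    intro x hxJ hx
    have h1 : x ∈ 𝔞 ^ k • (J : Submodule R R) := by
      have h2 : x ∈ (𝔞 ^ (m + k) • ⊤ ⊓ J : Submodule R R) := by
        refine ⟨?_, hxJ⟩
        simpa using hx
      rw [hm _ (Nat.le_add_right m k), Nat.add_sub_cancel_left] at h2
      exact Submodule.smul_mono le_rfl inf_le_right h2
    have key : ∀ y ∈ 𝔞 ^ k • (J : Submodule R R), ∀ hy : y ∈ J, g ⟨y, hy⟩ = 0 := by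
      intro y hy
      induction hy using Submodule.smul_induction_on' with
      | smul a ha b hb =>
        intro _
        have : g (a • ⟨b, hb⟩) = 0 := by
          rw [map_smul]
          exact Subtype.ext (hk a ha _ ⟨⟨b, hb⟩, rfl⟩)
        exact this
      | add y hy z hz h₁ h₂ =>
        intro _
        have hyJ := Submodule.smul_le_right hy
        have hzJ := Submodule.smul_le_right hz
        have : g (⟨y, hyJ⟩ + ⟨z, hzJ⟩) = 0 := by rw [map_add, h₁, h₂, add_zero]
        exact this
    exact key x h1 hxJ
  let q : J →ₗ[R] R ⧸ 𝔞 ^ (m + k) := Submodule.mkQ (𝔞 ^ (m + k)) ∘ₗ J.subtype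
  have hq : LinearMap.ker q ≤ LinearMap.ker ((torsionSubmodule 𝔞 M).subtype ∘ₗ g) := by
    intro x hx
    have : (x : R) ∈ 𝔞 ^ (m + k) := (Submodule.Quotient.mk_eq_zero _).1 hx
    rw [LinearMap.mem_ker, LinearMap.comp_apply, hm' x x.2 this, map_zero]
  let g' : (J ⧸ LinearMap.ker q) →ₗ[R] M := (LinearMap.ker q).liftQ _ hq
  obtain ⟨e, he⟩ := Module.Injective.out ((LinearMap.ker q).liftQ q le_rfl)
    (LinearMap.ker_eq_bot.1 (Submodule.ker_liftQ_eq_bot _ _ _ le_rfl)) g'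
  -- The extension `e` starts from `R/𝔞ᵐ⁺ᵏ`, so its values in `M` are automatically torsion.
  refine ⟨(e ∘ₗ Submodule.mkQ (𝔞 ^ (m + k))).codRestrict _ fun r => ⟨m + k, fun a ha => ?_⟩,
    fun x hx => Subtype.ext (he (Submodule.Quotient.mk ⟨x, hx⟩))⟩
  rw [← map_smul, LinearMap.comp_apply]
  have : Submodule.mkQ (𝔞 ^ (m + k)) (a • r) = 0 := by
    rw [Submodule.mkQ_apply, Submodule.Quotient.mk_eq_zero]
    exact Ideal.mul_mem_right _ _ ha
  rw [this, map_zero]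

/-- The torsion submodule, being injective, is a direct summand; the quotient is then a summand of
`M` as well. -/
theorem injective_torsionQuotient [IsNoetherianRing R] [Module.Injective R M] :
    Module.Injective R (M ⧸ torsionSubmodule 𝔞 M) := by
  have := injective_torsionSubmodule (𝔞 := 𝔞) (M := M)
  obtain ⟨r, hr⟩ := Module.Injective.out (torsionSubmodule 𝔞 M).subtype
    (torsionSubmodule 𝔞 M).subtype_injective LinearMap.id
  let s : (M ⧸ torsionSubmodule 𝔞 M) →ₗ[R] M :=
    (torsionSubmodule 𝔞 M).liftQ (LinearMap.id - (torsionSubmodule 𝔞 M).subtype ∘ₗ r) (by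
      intro x hx
      have := hr ⟨x, hx⟩
      simp only [Submodule.subtype_apply, LinearMap.id_apply] at this
      simp [this])
  have hs : ∀ x, (torsionSubmodule 𝔞 M).mkQ (s x) = x := by
    intro x
    obtain ⟨x, rfl⟩ := Submodule.mkQ_surjective _ x
    simp [s, Submodule.Quotient.mk_eq_zero]
  refine ⟨fun {X Y} _ _ _ _ f hf g => ?_⟩
  obtain ⟨e, he⟩ := Module.Injective.out f hf (s ∘ₗ g)
  exact ⟨(torsionSubmodule 𝔞 M).mkQ ∘ₗ e, fun x => by
    rw [LinearMap.comp_apply, he, LinearMap.comp_apply, hs]⟩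

theorem support_subset_zeroLocus (h : torsionSubmodule 𝔞 M = ⊤) :
    Module.support R M ⊆ PrimeSpectrum.zeroLocus (𝔞 : Set R) := by
  intro p hp
  by_contra hp'
  obtain ⟨r, hr, hrp⟩ := Set.not_subset.1 hp'
  refine (Module.notMem_support_iff'.2 fun x => ?_) hp
  obtain ⟨k, hk⟩ : x ∈ torsionSubmodule 𝔞 M := h ▸ Submodule.mem_top
  exact ⟨r ^ k, fun hrk => hrp (p.2.mem_of_pow_mem k hrk), hk _ (Ideal.pow_mem_pow hr k)⟩

theorem torsionSubmodule_eq_top_of_surjective (f : M →ₗ[R] N) (hf : Function.Surjective f)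
    (h : torsionSubmodule 𝔞 M = ⊤) : torsionSubmodule 𝔞 N = ⊤ := by
  rw [eq_top_iff]
  intro y _
  obtain ⟨x, rfl⟩ := hf y
  exact map_mem_torsionSubmodule 𝔞 f x (h ▸ Submodule.mem_top)

theorem torsionSubmodule_eq_top_of_injective (f : M →ₗ[R] N) (hf : Function.Injective f)
    (h : torsionSubmodule 𝔞 N = ⊤) : torsionSubmodule 𝔞 M = ⊤ := by
  rw [eq_top_iff]
  intro x _
  obtain ⟨k, hk⟩ : f x ∈ torsionSubmodule 𝔞 N := h ▸ Submodule.mem_top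
  exact ⟨k, fun r hr => hf (by rw [map_smul, hk r hr, map_zero])⟩

theorem torsionSubmodule_torsionSubmodule :
    torsionSubmodule 𝔞 (torsionSubmodule 𝔞 M) = ⊤ := by
  rw [eq_top_iff]
  rintro ⟨x, k, hk⟩ _
  exact ⟨k, fun r hr => Subtype.ext (hk r hr)⟩

end Torsion

/-! ### Membership of Ext modules in a Serre class along long exact sequences. -/

section Ext

variable {𝒮 : ObjectProperty (ModuleCat.{u} R)} [𝒮.IsSerreClass]

theorem prop_of_exact {M N P : Type u} [AddCommGroup M] [Module R M] [AddCommGroup N] [Module R N]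
    [AddCommGroup P] [Module R P] (f : M →ₗ[R] N) (g : N →ₗ[R] P) (h : Function.Exact f g)
    (hM : 𝒮 (ModuleCat.of R M)) (hP : 𝒮 (ModuleCat.of R P)) : 𝒮 (ModuleCat.of R N) := by
  let S : ShortComplex (ModuleCat.{u} R) := ShortComplex.mk (ModuleCat.ofHom f) (ModuleCat.ofHom g)
    (by ext x; exact h.apply_apply_eq_zero x)
  refine 𝒮.prop_X₂_of_exact (S := S) ?_ hM hP
  rw [ShortComplex.moduleCat_exact_iff]
  exact fun x hx => (h x).1 hx

theorem prop_of_subsingleton (M : Type u) [AddCommGroup M] [Module R M] [Subsingleton M] :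
    𝒮 (ModuleCat.of R M) :=
  𝒮.prop_of_isZero (ModuleCat.isZero_of_subsingleton _)

variable {𝔞 : Ideal R} {S : ShortComplex (ModuleCat.{u} R)}

theorem prop_extQuotient_X₂ (hS : S.ShortExact) {i : ℕ}
    (h₁ : 𝒮 (extQuotient 𝔞 i S.X₁))
    (h₃ : 𝒮 (extQuotient 𝔞 i S.X₃)) : 𝒮 (extQuotient 𝔞 i S.X₂) := by
  refine prop_of_exact ((Abelian.Ext.mk₀ S.f).postcompOfLinear R _ (add_zero i))
    ((Abelian.Ext.mk₀ S.g).postcompOfLinear R _ (add_zero i)) (fun x => ⟨fun hx => ?_, ?_⟩) h₁ h₃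
  · exact Abelian.Ext.covariant_sequence_exact₂ _ hS x hx
  · rintro ⟨y, rfl⟩
    simp

theorem prop_extQuotient_X₃ (hS : S.ShortExact) {i : ℕ}
    (h₂ : 𝒮 (extQuotient 𝔞 i S.X₂))
    (h₁ : 𝒮 (extQuotient 𝔞 (i + 1) S.X₁)) : 𝒮 (extQuotient 𝔞 i S.X₃) := by
  refine prop_of_exact ((Abelian.Ext.mk₀ S.g).postcompOfLinear R _ (add_zero i))
    (hS.extClass.postcompOfLinear R _ rfl) (fun x => ⟨fun hx => ?_, ?_⟩) h₂ h₁
  · exact Abelian.Ext.covariant_sequence_exact₃ _ hS x rfl hx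
  · rintro ⟨y, rfl⟩
    simp

theorem prop_extQuotient_X₁_succ (hS : S.ShortExact) {i : ℕ}
    (h₃ : 𝒮 (extQuotient 𝔞 i S.X₃))
    (h₂ : 𝒮 (extQuotient 𝔞 (i + 1) S.X₂)) : 𝒮 (extQuotient 𝔞 (i + 1) S.X₁) := by
  refine prop_of_exact (hS.extClass.postcompOfLinear R _ rfl)
    ((Abelian.Ext.mk₀ S.f).postcompOfLinear R _ (add_zero (i + 1)))
    (fun x => ⟨fun hx => ?_, ?_⟩) h₃ h₂
  · exact Abelian.Ext.covariant_sequence_exact₁ _ hS x hx rfl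
  · rintro ⟨y, rfl⟩
    simp

/-- Left exactness of Hom makes any condition on `S.X₃` unnecessary; `PUnit` stands for the zero
term at the left end. -/
theorem prop_extQuotient_X₁_zero (hS : S.ShortExact)
    (h₂ : 𝒮 (extQuotient 𝔞 0 S.X₂)) : 𝒮 (extQuotient 𝔞 0 S.X₁) := by
  have := hS.mono_f
  refine prop_of_exact (0 : PUnit.{u + 1} →ₗ[R] _)
    ((Abelian.Ext.mk₀ S.f).postcompOfLinear R _ (add_zero 0)) ?_ (prop_of_subsingleton _) h₂
  rw [LinearMap.exact_zero_iff_injective]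
  exact Abelian.Ext.postcomp_mk₀_injective_of_mono _ S.f

theorem prop_extQuotient_of_iso {M N : ModuleCat.{u} R} (e : M ≅ N) {i : ℕ}
    (h : 𝒮 (extQuotient 𝔞 i M)) : 𝒮 (extQuotient 𝔞 i N) := by
  refine prop_of_exact ((Abelian.Ext.mk₀ e.hom).postcompOfLinear R _ (add_zero i))
    (0 : _ →ₗ[R] PUnit.{u + 1}) ?_ h (prop_of_subsingleton _)
  rw [LinearMap.exact_zero_iff_surjective]
  exact fun x => ⟨x.comp (Abelian.Ext.mk₀ e.inv) (add_zero i), by simp⟩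

/-- A coresolution of `Y 0` in which the `i`-th step splits off the piece `H i` and then shifts the
dimension along a module `E i` with `Ext(R/𝔞, E i) = 0`. -/
structure TorsionCoresolution (𝔞 : Ideal R) where
  Y : ℕ → ModuleCat.{u} R
  H : ℕ → ModuleCat.{u} R
  T : ℕ → ModuleCat.{u} R
  E : ℕ → ModuleCat.{u} R
  ι : ∀ i, H i ⟶ Y i
  π : ∀ i, Y i ⟶ T i
  j : ∀ i, T i ⟶ E i
  q : ∀ i, E i ⟶ Y (i + 1)
  ι_π : ∀ i, ι i ≫ π i = 0
  j_q : ∀ i, j i ≫ q i = 0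
  shortExact_ι_π : ∀ i, (ShortComplex.mk (ι i) (π i) (ι_π i)).ShortExact
  shortExact_j_q : ∀ i, (ShortComplex.mk (j i) (q i) (j_q i)).ShortExact
  injective_E : ∀ i, Injective (E i)
  hom_E_eq_zero : ∀ i (f : ModuleCat.of R (R ⧸ 𝔞) ⟶ E i), f = 0

/-! ### Dimension shifting along a torsion coresolution. -/

namespace TorsionCoresolution

variable (C : TorsionCoresolution 𝔞)

theorem prop_extQuotient_E (i p : ℕ) : 𝒮 (extQuotient 𝔞 p (C.E i)) := by
  have := C.injective_E i
  have : Subsingleton (Abelian.Ext (ModuleCat.of R (R ⧸ 𝔞)) (C.E i) p) := by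
    cases p with
    | zero =>
      have : Subsingleton (ModuleCat.of R (R ⧸ 𝔞) ⟶ C.E i) :=
        ⟨fun f g => by rw [C.hom_E_eq_zero i f, C.hom_E_eq_zero i g]⟩
      exact Abelian.Ext.addEquiv₀.toEquiv.subsingleton
    | succ p =>
      exact ⟨fun x y => by
        rw [Abelian.Ext.eq_zero_of_injective x, Abelian.Ext.eq_zero_of_injective y]⟩
  exact prop_of_subsingleton _

theorem prop_extQuotient_T_zero (i : ℕ) : 𝒮 (extQuotient 𝔞 0 (C.T i)) :=
  prop_extQuotient_X₁_zero (C.shortExact_j_q i) (C.prop_extQuotient_E i 0)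

/-- The basic shift: the Ext modules of `C.E i` lie in `𝒮`, so one degree is traded for one step of
the coresolution. -/
theorem prop_extQuotient_T_succ_iff {i p : ℕ} :
    𝒮 (extQuotient 𝔞 (p + 1) (C.T i)) ↔ 𝒮 (extQuotient 𝔞 p (C.Y (i + 1))) :=
  ⟨fun h => prop_extQuotient_X₃ (C.shortExact_j_q i) (C.prop_extQuotient_E i p) h,
    fun h => prop_extQuotient_X₁_succ (C.shortExact_j_q i) h (C.prop_extQuotient_E i (p + 1))⟩

/-- The induction on `p` needs all `i` at once: degree `p + 1` at step `i` reduces to degree `p` at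
step `i + 1`. -/
theorem prop_extQuotient_Y (hH : ∀ i p, 𝒮 (extQuotient 𝔞 p (C.H i))) (p : ℕ) :
    ∀ i, 𝒮 (extQuotient 𝔞 p (C.Y i)) := by
  induction p with
  | zero =>
    exact fun i => prop_extQuotient_X₂ (C.shortExact_ι_π i) (hH i 0) (C.prop_extQuotient_T_zero i)
  | succ p ih =>
    exact fun i => prop_extQuotient_X₂ (C.shortExact_ι_π i) (hH i _)
      (C.prop_extQuotient_T_succ_iff.2 (ih (i + 1)))

theorem prop_extQuotient_H_of_T {i : ℕ} (hY : ∀ p, 𝒮 (extQuotient 𝔞 p (C.Y i)))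
    (hT : ∀ p, 𝒮 (extQuotient 𝔞 p (C.T i))) (p : ℕ) : 𝒮 (extQuotient 𝔞 p (C.H i)) := by
  cases p with
  | zero => exact prop_extQuotient_X₁_zero (C.shortExact_ι_π i) (hY 0)
  | succ p => exact prop_extQuotient_X₁_succ (C.shortExact_ι_π i) (hT p) (hY _)

/-- The coresolution of `Y 1` obtained by dropping the first step. -/
def tail : TorsionCoresolution 𝔞 where
  Y i := C.Y (i + 1)
  H i := C.H (i + 1)
  T i := C.T (i + 1)
  E i := C.E (i + 1)
  ι i := C.ι (i + 1)
  π i := C.π (i + 1)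
  j i := C.j (i + 1)
  q i := C.q (i + 1)
  ι_π i := C.ι_π (i + 1)
  j_q i := C.j_q (i + 1)
  shortExact_ι_π i := C.shortExact_ι_π (i + 1)
  shortExact_j_q i := C.shortExact_j_q (i + 1)
  injective_E i := C.injective_E (i + 1)
  hom_E_eq_zero i := C.hom_E_eq_zero (i + 1)

theorem prop_extQuotient_H (n : ℕ) : ∀ (C : TorsionCoresolution 𝔞),
    (∀ i, i ≠ n → ∀ p, 𝒮 (extQuotient 𝔞 p (C.H i))) →
    (∀ p, n ≤ p → 𝒮 (extQuotient 𝔞 p (C.Y 0))) → ∀ p, 𝒮 (extQuotient 𝔞 p (C.H n)) := by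
  induction n with
  | zero =>
    intro C hH hY
    refine C.prop_extQuotient_H_of_T (fun p => hY p p.zero_le) fun p => ?_
    cases p with
    | zero => exact C.prop_extQuotient_T_zero 0
    | succ p =>
      -- The exceptional index `0` is absent from the tail, whose pieces all have Ext in `𝒮`.
      exact C.prop_extQuotient_T_succ_iff.2
        (C.tail.prop_extQuotient_Y (fun i => hH (i + 1) i.succ_ne_zero) p 0)
  | succ n ih =>
    intro C hH hY
    refine ih C.tail (fun i hi => hH (i + 1) (by simpa using hi)) fun p hp => ?_
    -- Degree `p` of `Y 1` is degree `p + 1` of `T 0`, so the bound `n + 1` for `Y 0` becomes `n`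
    -- for the tail.
    exact C.prop_extQuotient_T_succ_iff.1 (prop_extQuotient_X₃ (C.shortExact_ι_π 0)
      (hY (p + 1) (by lia)) (hH 0 n.succ_ne_zero.symm _))

end TorsionCoresolution

end Ext

/-! ### Kernels and images modulo torsion. -/

section TorsionSubquotients

variable (𝔞 : Ideal R) {L M N : Type u} [AddCommGroup L] [Module R L] [AddCommGroup M] [Module R M]
  [AddCommGroup N] [Module R N]

/-- The kernel of `g`, regarded as a submodule of the quotient by the `𝔞`-torsion. -/
def kerModTorsion (g : M →ₗ[R] N) : Submodule R (M ⧸ torsionSubmodule 𝔞 M) :=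
  (LinearMap.ker g).map (torsionSubmodule 𝔞 M).mkQ

variable {𝔞} (B : Submodule R M) (g : M →ₗ[R] N)

/-- The projection of `ker g ⧸ B` onto the image of `ker g` modulo torsion, for `B` torsion. -/
def toKerModTorsion (hB : B ≤ torsionSubmodule 𝔞 M) :
    (LinearMap.ker g ⧸ B.submoduleOf (LinearMap.ker g)) →ₗ[R] kerModTorsion 𝔞 g :=
  Submodule.liftQ _ ((torsionSubmodule 𝔞 M).mkQ.restrict
      fun _ hx => Submodule.mem_map_of_mem (p := LinearMap.ker g) hx) fun _ hx =>
    Subtype.ext ((Submodule.Quotient.mk_eq_zero _).2 (hB hx))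

theorem toKerModTorsion_surjective (hB : B ≤ torsionSubmodule 𝔞 M) :
    Function.Surjective (toKerModTorsion B g hB) := by
  rintro ⟨_, x, hx, rfl⟩
  exact ⟨Submodule.Quotient.mk ⟨x, hx⟩, rfl⟩

theorem toKerModTorsion_mk_eq_zero_iff (hB : B ≤ torsionSubmodule 𝔞 M) (x : LinearMap.ker g) :
    toKerModTorsion B g hB (Submodule.Quotient.mk x) = 0 ↔ (x : M) ∈ torsionSubmodule 𝔞 M := by
  rw [← Submodule.Quotient.mk_eq_zero, Subtype.ext_iff]
  rfl

variable (f : L →ₗ[R] M)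

/-- The map `L ⧸ Γ_𝔞(L) → ker g ⧸ f(Γ_𝔞(L))` induced by `f`. -/
def torsionQuotientToKer (hB : B = (torsionSubmodule 𝔞 L).map f) (h : Function.Exact f g) :
    (L ⧸ torsionSubmodule 𝔞 L) →ₗ[R] LinearMap.ker g ⧸ B.submoduleOf (LinearMap.ker g) :=
  Submodule.liftQ _ (Submodule.mkQ _ ∘ₗ f.codRestrict (LinearMap.ker g) h.apply_apply_eq_zero)
    fun _ hx => (Submodule.Quotient.mk_eq_zero _).2 (hB ▸ Submodule.mem_map_of_mem hx)

theorem torsionQuotientToKer_surjective (hB : B = (torsionSubmodule 𝔞 L).map f)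
    (h : Function.Exact f g) : Function.Surjective (torsionQuotientToKer B g f hB h) := by
  intro y
  obtain ⟨⟨y, hy⟩, rfl⟩ := Submodule.Quotient.mk_surjective _ y
  obtain ⟨x, rfl⟩ := (h y).1 hy
  exact ⟨Submodule.Quotient.mk x, rfl⟩

/-- An element `y` satisfies `f y ∈ f(Γ(L))` exactly when `y ∈ ker f + Γ(L)`. -/
theorem exact_kerModTorsion_torsionQuotientToKer (hB : B = (torsionSubmodule 𝔞 L).map f)
    (h : Function.Exact f g) :
    Function.Exact (kerModTorsion 𝔞 f).subtype (torsionQuotientToKer B g f hB h) := by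
  intro y
  obtain ⟨y, rfl⟩ := Submodule.Quotient.mk_surjective _ y
  have key : torsionQuotientToKer B g f hB h (Submodule.Quotient.mk y) = 0 ↔ f y ∈ B :=
    Submodule.Quotient.mk_eq_zero _
  rw [key]
  constructor
  · intro hy
    rw [hB] at hy
    obtain ⟨z, hz, hzy⟩ := hy
    refine ⟨⟨_, y - z, ?_, rfl⟩, ?_⟩
    · simp [hzy]
    · simpa [Submodule.Quotient.mk_eq_zero] using hz
  · rintro ⟨⟨_, z, hz, rfl⟩, hzy⟩
    have : y - z ∈ torsionSubmodule 𝔞 L := by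
      rw [← Submodule.Quotient.mk_eq_zero, Submodule.Quotient.mk_sub]
      exact sub_eq_zero.2 hzy.symm
    rw [hB]
    refine ⟨y - z, this, ?_⟩
    rw [map_sub, LinearMap.mem_ker.1 hz, sub_zero]

end TorsionSubquotients

/-! ### Homology of the torsion of a short complex. -/

section Homology

variable (𝔞 : Ideal R) (S : ShortComplex (ModuleCat.{u} R))

theorem map_torsionSubmodule_le {L M : Type u} [AddCommGroup L] [Module R L] [AddCommGroup M]
    [Module R M] (f : L →ₗ[R] M) :
    (torsionSubmodule 𝔞 L).map f ≤ torsionSubmodule 𝔞 M := by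
  rintro _ ⟨x, hx, rfl⟩
  exact map_mem_torsionSubmodule 𝔞 f x hx

/-- The homology of `Γ_𝔞(S)`, in terms of elements, maps to `ker S.g ⧸ S.f(Γ_𝔞(S.X₁))`. -/
def torsionHomologyToQuotient :
    (S.map (torsionFunctor 𝔞)).moduleCatLeftHomologyData.H →ₗ[R]
      LinearMap.ker S.g.hom ⧸
        ((torsionSubmodule 𝔞 S.X₁).map S.f.hom).submoduleOf (LinearMap.ker S.g.hom) :=
  Submodule.mapQ (LinearMap.range (S.map (torsionFunctor 𝔞)).moduleCatToCycles) _
    ((torsionSubmodule 𝔞 S.X₂).subtype.restrict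
      (p := LinearMap.ker ((S.map (torsionFunctor 𝔞)).g.hom)) (q := LinearMap.ker S.g.hom)
      fun _ hx => congrArg Subtype.val hx) (by
    rintro _ ⟨x, rfl⟩
    exact ⟨x.1, x.2, rfl⟩)

/-- Both sides divide out the same boundaries `S.f(Γ(S.X₁))`; only the cycles are enlarged. -/
theorem torsionHomologyToQuotient_injective :
    Function.Injective (torsionHomologyToQuotient 𝔞 S) := by
  refine LinearMap.ker_eq_bot.1 (LinearMap.ker_eq_bot'.2 fun x hx => ?_)
  obtain ⟨x, rfl⟩ := Submodule.Quotient.mk_surjective _ x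
  obtain ⟨y, hy, hyx⟩ := (Submodule.Quotient.mk_eq_zero _).1 hx
  exact (Submodule.Quotient.mk_eq_zero _).2 ⟨⟨y, hy⟩, Subtype.ext (Subtype.ext hyx)⟩

/-- The cycles of `Γ(S)` are the torsion elements of `ker S.g`, and the boundaries divided out are
themselves torsion. -/
theorem exact_torsionHomologyToQuotient_toKerModTorsion :
    Function.Exact (torsionHomologyToQuotient 𝔞 S)
      (toKerModTorsion _ S.g.hom (map_torsionSubmodule_le 𝔞 S.f.hom)) := by
  intro y
  obtain ⟨y, rfl⟩ := Submodule.Quotient.mk_surjective _ y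
  rw [toKerModTorsion_mk_eq_zero_iff]
  constructor
  · intro hy
    exact ⟨Submodule.Quotient.mk ⟨⟨y, hy⟩, Subtype.ext y.2⟩, rfl⟩
  · rintro ⟨x, hx⟩
    obtain ⟨x, rfl⟩ := Submodule.Quotient.mk_surjective _ x
    have h₁ := (Submodule.Quotient.eq _).1 hx
    have h₂ := sub_mem x.1.2 (map_torsionSubmodule_le 𝔞 S.f.hom h₁)
    have h₃ : (x.1.1 : S.X₂) - (x.1.1 - y) ∈ torsionSubmodule 𝔞 S.X₂ := h₂
    rwa [sub_sub_cancel] at h₃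

/-- The short complex `H(Γ_𝔞(S)) → ker S.g ⧸ S.f(Γ_𝔞(S.X₁)) → ker S.g ⧸ Γ_𝔞(ker S.g)`. -/
def torsionHomologyShortComplex : ShortComplex (ModuleCat.{u} R) where
  X₁ := (S.map (torsionFunctor 𝔞)).moduleCatLeftHomologyData.H
  X₂ := ModuleCat.of R (LinearMap.ker S.g.hom ⧸
    ((torsionSubmodule 𝔞 S.X₁).map S.f.hom).submoduleOf (LinearMap.ker S.g.hom))
  X₃ := ModuleCat.of R (kerModTorsion 𝔞 S.g.hom)
  f := ModuleCat.ofHom (torsionHomologyToQuotient 𝔞 S)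
  g := ModuleCat.ofHom (toKerModTorsion _ S.g.hom (map_torsionSubmodule_le 𝔞 S.f.hom))
  zero := ModuleCat.hom_ext
    (exact_torsionHomologyToQuotient_toKerModTorsion 𝔞 S).linearMap_comp_eq_zero

theorem torsionHomologyShortComplex_shortExact : (torsionHomologyShortComplex 𝔞 S).ShortExact :=
  ModuleCat.shortComplex_shortExact _ (exact_torsionHomologyToQuotient_toKerModTorsion 𝔞 S)
    (torsionHomologyToQuotient_injective 𝔞 S) (toKerModTorsion_surjective _ _ (map_torsionSubmodule_le 𝔞 S.f.hom))

theorem shortExact_of_iso_left {S : ShortComplex (ModuleCat.{u} R)} (hS : S.ShortExact)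
    {A : ModuleCat.{u} R} (e : A ≅ S.X₁) :
    (ShortComplex.mk (e.hom ≫ S.f) S.g (by simp)).ShortExact :=
  ShortComplex.shortExact_of_iso (ShortComplex.isoMk e.symm (Iso.refl _) (Iso.refl _)) hS

/-- Homology is a quotient of a submodule of the torsion module `Γ(S.X₂)`. -/
theorem torsionSubmodule_homology_eq_top :
    torsionSubmodule 𝔞 (S.map (torsionFunctor 𝔞)).homology = ⊤ := by
  refine torsionSubmodule_eq_top_of_surjective
    (S.map (torsionFunctor 𝔞)).homologyπ.hom
    ((ModuleCat.epi_iff_surjective _).1 inferInstance) ?_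
  refine torsionSubmodule_eq_top_of_injective (S.map (torsionFunctor 𝔞)).iCycles.hom
    ((ModuleCat.mono_iff_injective _).1 inferInstance) ?_
  exact torsionSubmodule_torsionSubmodule

end Homology

/-! ### The torsion coresolution attached to an injective resolution. -/

section Resolution

variable (𝔞 : Ideal R) {X : ModuleCat.{u} R} (I : InjectiveResolution X)

/-- The short complex of the injective resolution `I` in degree `i`. -/
noncomputable abbrev resolutionShortComplex (i : ℕ) : ShortComplex (ModuleCat.{u} R) :=
  I.cocomplex.sc' ((ComplexShape.up ℕ).prev i) i (i + 1)

/-- Local cohomology is the homology of the `𝔞`-torsion of an injective resolution. -/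
noncomputable def localCohomologyModuleIso (i : ℕ) :
    localCohomologyModule 𝔞 i X ≅
      ((resolutionShortComplex I i).map (torsionFunctor 𝔞)).homology :=
  I.isoRightDerivedObj (torsionFunctor 𝔞) i ≪≫
    ShortComplex.homologyMapIso
      ((((torsionFunctor 𝔞).mapHomologicalComplex _).obj I.cocomplex).isoSc'
        ((ComplexShape.up ℕ).prev i) i (i + 1) rfl (by simp))

/-- Local cohomology is the left term of the short complex `torsionHomologyShortComplex`. -/
noncomputable def localCohomologyModuleIsoX₁ (i : ℕ) :
    localCohomologyModule 𝔞 i X ≅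
      (torsionHomologyShortComplex 𝔞 (resolutionShortComplex I i)).X₁ :=
  localCohomologyModuleIso 𝔞 I i ≪≫ ShortComplex.moduleCatHomologyIso _

theorem support_localCohomologyModule_subset (i : ℕ) :
    Module.support R (localCohomologyModule 𝔞 i X) ⊆ PrimeSpectrum.zeroLocus (𝔞 : Set R) := by
  have e := localCohomologyModuleIso 𝔞 (InjectiveResolution.of X) i
  exact support_subset_zeroLocus (torsionSubmodule_eq_top_of_injective e.hom.hom
    ((ModuleCat.mono_iff_injective _).1 inferInstance) (torsionSubmodule_homology_eq_top 𝔞 _))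

theorem exact_d_succ (i : ℕ) :
    Function.Exact (I.cocomplex.d i (i + 1)).hom (I.cocomplex.d (i + 1) (i + 1 + 1)).hom := by
  have := I.exact_succ i
  rw [ShortComplex.moduleCat_exact_iff_range_eq_ker] at this
  exact LinearMap.exact_iff.2 this.symm

/-- The index `prev (i + 1)` equals `i` only propositionally; this identifies the submodules without
casts. -/
theorem map_d_prev_succ (i : ℕ) :
    (torsionSubmodule 𝔞 (I.cocomplex.X ((ComplexShape.up ℕ).prev (i + 1)))).map
        (I.cocomplex.d ((ComplexShape.up ℕ).prev (i + 1)) (i + 1)).hom =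
      (torsionSubmodule 𝔞 (I.cocomplex.X i)).map (I.cocomplex.d i (i + 1)).hom := by
  generalize h : (ComplexShape.up ℕ).prev (i + 1) = k
  obtain rfl : i = k := by simpa using h
  rfl

/-- No index precedes `0`: `prev 0` takes the default value `0`, and the differential from `0` to
`0` is zero. -/
theorem map_d_prev_zero :
    (torsionSubmodule 𝔞 (I.cocomplex.X ((ComplexShape.up ℕ).prev 0))).map
        (I.cocomplex.d ((ComplexShape.up ℕ).prev 0) 0).hom = ⊥ := by
  rw [I.cocomplex.shape _ _ (by simp), ModuleCat.hom_zero, Submodule.map_zero]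

/-- The torsion coresolution of `X` built from an injective resolution `I` of `X`: its `i`-th term
is the module of `i`-cocycles of `I` modulo the `i`-coboundaries of `Γ_𝔞(I)`. -/
noncomputable def torsionCoresolution [IsNoetherianRing R] : TorsionCoresolution 𝔞 where
  Y i := (torsionHomologyShortComplex 𝔞 (resolutionShortComplex I i)).X₂
  H i := localCohomologyModule 𝔞 i X
  T i := (torsionHomologyShortComplex 𝔞 (resolutionShortComplex I i)).X₃
  E i := ModuleCat.of R (I.cocomplex.X i ⧸ torsionSubmodule 𝔞 (I.cocomplex.X i))
  ι i := (localCohomologyModuleIsoX₁ 𝔞 I i).hom ≫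
    (torsionHomologyShortComplex 𝔞 (resolutionShortComplex I i)).f
  π i := (torsionHomologyShortComplex 𝔞 (resolutionShortComplex I i)).g
  j i := ModuleCat.ofHom (kerModTorsion 𝔞 _).subtype
  -- Exactness of `I` in degree `i + 1` makes the differential map onto the cocycles, so this is
  -- onto the next `Y`.
  q i := ModuleCat.ofHom
    (torsionQuotientToKer _ _ (I.cocomplex.d i (i + 1)).hom (map_d_prev_succ 𝔞 I i)
      (exact_d_succ I i))
  ι_π i := by rw [Category.assoc, ShortComplex.zero, Limits.comp_zero]
  j_q i := ModuleCat.hom_ext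
    (exact_kerModTorsion_torsionQuotientToKer _ _ _ (map_d_prev_succ 𝔞 I i)
      (exact_d_succ I i)).linearMap_comp_eq_zero
  shortExact_ι_π i := shortExact_of_iso_left
    (torsionHomologyShortComplex_shortExact 𝔞 (resolutionShortComplex I i))
    (localCohomologyModuleIsoX₁ 𝔞 I i)
  shortExact_j_q i := ModuleCat.shortComplex_shortExact _
    (exact_kerModTorsion_torsionQuotientToKer _ _ _ (map_d_prev_succ 𝔞 I i) (exact_d_succ I i))
    (Submodule.subtype_injective _)
    (torsionQuotientToKer_surjective _ _ _ (map_d_prev_succ 𝔞 I i) (exact_d_succ I i))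
  injective_E i := by
    have : Module.Injective R (I.cocomplex.X i) :=
      (Module.injective_iff_injective_object R _).2 (I.injective i)
    exact (Module.injective_iff_injective_object R _).1 injective_torsionQuotient
  hom_E_eq_zero i f := ModuleCat.hom_ext (linearMap_torsionQuotient_eq_zero f.hom)

theorem submoduleOf_map_d_prev_zero :
    ((torsionSubmodule 𝔞 _).map (resolutionShortComplex I 0).f.hom).submoduleOf
      (LinearMap.ker (resolutionShortComplex I 0).g.hom) = ⊥ := by
  have : (torsionSubmodule 𝔞 _).map (resolutionShortComplex I 0).f.hom = ⊥ := map_d_prev_zero 𝔞 I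
  rw [this, Submodule.submoduleOf, Submodule.comap_bot, Submodule.ker_subtype]

/-- The initial term of the torsion coresolution is `X`. -/
noncomputable def torsionCoresolutionYZeroIso [IsNoetherianRing R] :
    (torsionCoresolution 𝔞 I).Y 0 ≅ X :=
  -- Nothing is divided out in degree `0`, which leaves the kernel of the first differential, that
  -- is `X`.
  (Submodule.quotEquivOfEqBot _ (submoduleOf_map_d_prev_zero 𝔞 I)).toModuleIso ≪≫
    (ModuleCat.kernelIsLimit (I.cocomplex.d 0 1)).conePointUniqueUpToIso I.isLimitKernelFork

end Resolution

end SerreCofinite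

open SerreCofinite in
theorem theorem4p2 {R : Type u} [CommRing R] [IsNoetherianRing R]
    (𝒮 : ObjectProperty (ModuleCat.{u} R)) [𝒮.IsSerreClass]
    (𝔞 : Ideal R) (X : ModuleCat.{u} R) (n : ℕ)
    (hX : ∀ i : ℕ, i ≠ n →
      SerreCofinite.IsCofinite 𝒮 𝔞 (SerreCofinite.localCohomologyModule 𝔞 i X)) :
    List.TFAE [
      ∀ i : ℕ, 𝒮 (SerreCofinite.extQuotient 𝔞 i X),
      ∀ i : ℕ, n ≤ i → 𝒮 (SerreCofinite.extQuotient 𝔞 i X),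
      SerreCofinite.IsCofinite 𝒮 𝔞 (SerreCofinite.localCohomologyModule 𝔞 n X)] := by
  let I := InjectiveResolution.of X
  let C := torsionCoresolution 𝔞 I
  have e : C.Y 0 ≅ X := torsionCoresolutionYZeroIso 𝔞 I
  tfae_have 1 → 2 := fun h i _ => h i
  tfae_have 2 → 3 := fun h => ⟨support_localCohomologyModule_subset 𝔞 n,
    C.prop_extQuotient_H n (fun i hi => (hX i hi).2)
      fun p hp => prop_extQuotient_of_iso e.symm (h p hp)⟩
  tfae_have 3 → 1 := fun h i => prop_extQuotient_of_iso e
    (C.prop_extQuotient_Y (fun i => if hi : i = n then hi ▸ h.2 else (hX i hi).2) i 0)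
  tfae_finish
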